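/- Let $\mathbb F=\mathbb R$ or $\mathbb C$. Let $S$ be a compact connected complex manifold, $p:\tilde S\to S$ its universal covering (with the lifted complex structure), and $\Gamma\cong\pi_1(S)$ the group of deck transformations of $p$. Let $W$ be a finite-dimensional vector space over $\mathbb F$ and let $\rho:\Gamma\to GL(W)$ be a homomorphism such that $\Gamma$ contains a proximal element, i.e. some $\gamma\in\Gamma$ for which the maximal characteristic exponent of $\rho(\gamma)$ is simple; here the characteristic exponents of $A\in GL(W)$ are the numbers $\log|\lambda|$, where $\lambda$ runs through the complex roots of the characteristic polynomial of $A$ over $\mathbb F$, counted with multiplicity, and simple means of multiplicity one. Let $\Gamma$ act on the projective space $P(W)$ via $\rho$, and let $M_\rho=(\tilde S\times P(W))/\Gamma$ be the quotient by the diagonal action $\gamma\cdot(z,x)=(\gamma z,\rho(\gamma)x)$, with the foliation $\mathcal F_\rho$ whose leaves are the images of the sets $\tilde S\times\{x\}$, $x\in P(W)$, each leaf carrying the complex structure for which the covering map $z\mapsto[z,x]$ from $\tilde S$ onto the leaf is locally biholomorphic. Then the foliated bundle $(M_\rho,\mathcal F_\rho)$ is holomorphically plain: every continuous function $f:M_\rho\to\mathbb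 C$ that is holomorphic along every leaf is constant on every leaf. -/

import Mathlib

open scoped Manifold ContDiff LinearAlgebra.Projectivization

noncomputable section

/-! ## Universal coverings, deck transformations and foliated bundles -/

/-- The group of deck transformations of a map `p : T → S`: the self-homeomorphisms `γ` of `T`
with `p ∘ γ = p`. -/
def deckGroup {T S : Type*} [TopologicalSpace T] (p : T → S) : Subgroup (T ≃ₜ T) where
  carrier := {γ | ∀ z, p (γ z) = p z}
  one_mem' := fun _ => rfl
  mul_mem' := fun {a b} ha hb z => (ha (b z)).trans (hb z)
  inv_mem' := fun {a} ha z => by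
    have h := ha (a.symm z)
    rw [a.apply_symm_apply] at h
    exact h.symm

/-- `p : T → S` is a universal covering of the complex manifold `S`, where `T` carries the
complex structure lifted from `S`: `T` is simply connected, `p` is a covering map, and `p` is
locally biholomorphic. -/
structure IsHolomorphicUniversalCovering (E : Type*) [NormedAddCommGroup E] [NormedSpace ℂ E]
    {T S : Type*} [TopologicalSpace T] [ChartedSpace E T] [TopologicalSpace S] [ChartedSpace E S]
    (p : T → S) : Prop where
  simplyConnected : SimplyConnectedSpace T
  isCoveringMap : IsCoveringMap p
  isLocalBiholomorphism : IsLocalDiffeomorph 𝓘(ℂ, E) 𝓘(ℂ, E) ω p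

section FoliatedBundle

variable {T S X : Type*} [TopologicalSpace T] [TopologicalSpace X]

/-- The orbit equivalence relation of the diagonal action `γ • (z, x) = (γ z, ρ(γ) x)` of the
deck group on `T × X`. -/
def foliatedBundleSetoid (p : T → S) (ρ : deckGroup p →* (X ≃ₜ X)) : Setoid (T × X) where
  r a b := ∃ γ : deckGroup p, b = ((γ : T ≃ₜ T) a.1, ρ γ a.2)
  iseqv :=
    { refl := fun a => ⟨1, by simp⟩
      symm := by
        rintro ⟨z, x⟩ _ ⟨γ, rfl⟩
        refine ⟨γ⁻¹, ?_⟩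
        have h1 : ((γ⁻¹ : deckGroup p) : T ≃ₜ T) ((γ : T ≃ₜ T) z) = z :=
          (γ : T ≃ₜ T).symm_apply_apply z
        have h2 : ρ γ⁻¹ (ρ γ x) = x := by
          rw [map_inv]
          exact (ρ γ).symm_apply_apply x
        simp only [h1, h2]
      trans := by
        rintro ⟨z, x⟩ _ _ ⟨γ, rfl⟩ ⟨δ, rfl⟩
        exact ⟨δ * γ, by rw [map_mul]; rfl⟩ }

/-- The total space `M_ρ = (T × X) / Γ` of the foliated bundle with fiber `X` defined by an action
`ρ` of the deck group `Γ` of `p : T → S` on `X`. -/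
def FoliatedBundle (p : T → S) (ρ : deckGroup p →* (X ≃ₜ X)) : Type _ :=
  Quotient (foliatedBundleSetoid p ρ)

namespace FoliatedBundle

variable (p : T → S) (ρ : deckGroup p →* (X ≃ₜ X))

/-- `M_ρ` carries the quotient topology. -/
instance : TopologicalSpace (FoliatedBundle p ρ) :=
  inferInstanceAs (TopologicalSpace (Quotient (foliatedBundleSetoid p ρ)))

/-- The parametrization `z ↦ [z, x]` of the leaf through the points `[z, x]`. -/
def leafMap (x : X) (z : T) : FoliatedBundle p ρ :=
  Quotient.mk (foliatedBundleSetoid p ρ) (z, x)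

/-- The leaf of the foliation `F_ρ` that is the image of `T × {x}`. -/
def leaf (x : X) : Set (FoliatedBundle p ρ) :=
  Set.range (leafMap p ρ x)

variable {p ρ}

/-- `f` is holomorphic along every leaf. The leaf of `x` is `T` modulo the stabilizer of `x` in the
deck group, with the complex structure for which the covering `leafMap p ρ x` from `T` onto the
leaf is locally biholomorphic; so a function on the leaf is holomorphic if and only if its
composition with `leafMap p ρ x` is holomorphic on `T`. -/
def IsLeafwiseHolomorphic (E : Type*) [NormedAddCommGroup E] [NormedSpace ℂ E]
    [ChartedSpace E T] (f : FoliatedBundle p ρ → ℂ) : Prop :=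
  ∀ x : X, MDifferentiable 𝓘(ℂ, E) 𝓘(ℂ, ℂ) (fun z : T => f (leafMap p ρ x z))

/-- `f` is constant on every leaf. -/
def IsLeafwiseConstant (f : FoliatedBundle p ρ → ℂ) : Prop :=
  ∀ x : X, ∀ a ∈ leaf p ρ x, ∀ b ∈ leaf p ρ x, f a = f b

variable (p ρ)

/-- `(M_ρ, F_ρ)` is holomorphically plain: every continuous leafwise holomorphic function
`M_ρ → ℂ` is leafwise constant. -/
def HolomorphicallyPlain (E : Type*) [NormedAddCommGroup E] [NormedSpace ℂ E]
    [ChartedSpace E T] : Prop :=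
  ∀ f : FoliatedBundle p ρ → ℂ,
    Continuous f → IsLeafwiseHolomorphic E f → IsLeafwiseConstant f

end FoliatedBundle

end FoliatedBundle

/-! ## Projective spaces and proximal linear maps -/

section Projective

variable {𝕜 : Type*} [RCLike 𝕜] {W : Type*} [NormedAddCommGroup W] [NormedSpace 𝕜 W]

/-- The projective space `P(W)` carries the quotient topology from `W \ {0}`. -/
instance Projectivization.instTopologicalSpaceQuotient : TopologicalSpace (ℙ 𝕜 W) :=
  inferInstanceAs (TopologicalSpace (Quotient (projectivizationSetoid 𝕜 W)))

variable [FiniteDimensional 𝕜 W]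

theorem continuous_projectivization_smul (g : LinearMap.GeneralLinearGroup 𝕜 W) :
    Continuous (fun x : ℙ 𝕜 W => g • x) := by
  have hg : Continuous (fun v : W => g • v) :=
    LinearMap.continuous_of_finiteDimensional (g : W →ₗ[𝕜] W)
  refine continuous_coinduced_dom.2 ?_
  have h : Continuous (fun v : { v : W // v ≠ 0 } =>
      (⟨g • (v : W), (smul_ne_zero_iff_ne g).mpr v.2⟩ : { v : W // v ≠ 0 })) :=
    (hg.comp continuous_subtype_val).subtype_mk _
  exact continuous_coinduced_rng.comp h

variable (𝕜 W)

/-- The action of `GL(W)` on `P(W)` by homeomorphisms. -/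
def projectiveAction : LinearMap.GeneralLinearGroup 𝕜 W →* (ℙ 𝕜 W ≃ₜ ℙ 𝕜 W) where
  toFun g :=
    { toEquiv := MulAction.toPerm g
      continuous_toFun := continuous_projectivization_smul g
      continuous_invFun := continuous_projectivization_smul g⁻¹ }
  map_one' := by
    ext x
    exact one_smul (LinearMap.GeneralLinearGroup 𝕜 W) x
  map_mul' g h := by
    ext x
    exact mul_smul g h x

end Projective

/-- The inclusion of `𝕜 = ℝ` or `𝕜 = ℂ` into `ℂ`. -/
def rclikeToComplex (𝕜 : Type*) [RCLike 𝕜] : 𝕜 →+* ℂ where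
  toFun x := ⟨RCLike.re x, RCLike.im x⟩
  map_one' := by apply Complex.ext <;> simp
  map_zero' := by apply Complex.ext <;> simp
  map_add' x y := by apply Complex.ext <;> simp
  map_mul' x y := by apply Complex.ext <;> simp

/-- The characteristic exponents of a linear automorphism `A` of `W`: the numbers `log |λ|`, where
`λ` runs through the complex roots of the characteristic polynomial of `A`, with multiplicity. -/
def characteristicExponents {𝕜 : Type*} [RCLike 𝕜] {W : Type*} [AddCommGroup W] [Module 𝕜 W]
    [FiniteDimensional 𝕜 W] (A : LinearMap.GeneralLinearGroup 𝕜 W) : Multiset ℝ :=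
  (((A : W →ₗ[𝕜] W).charpoly.map (rclikeToComplex 𝕜)).roots).map (fun z => Real.log ‖z‖)

/-- `A` is proximal: its maximal characteristic exponent exists and is simple, that is, of
multiplicity one. -/
def IsProximal {𝕜 : Type*} [RCLike 𝕜] {W : Type*} [AddCommGroup W] [Module 𝕜 W]
    [FiniteDimensional 𝕜 W] (A : LinearMap.GeneralLinearGroup 𝕜 W) : Prop :=
  ∃ a ∈ characteristicExponents A,
    (∀ b ∈ characteristicExponents A, b ≤ a) ∧ (characteristicExponents A).count a = 1

end

/-! ## Integrals of bounded holomorphic families -/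

/-! Lift `f` to a family Φ(z, w) on T × (W \ {0}): homogeneous of degree 0 in w, holomorphic in z,
invariant under Γ, and bounded because Γ acts cocompactly on T. The main point is that Φ does not
depend on w. Granting this, each z ↦ Φ(z, w) is Γ-invariant, so its modulus attains its maximum on a
compact set, and the maximum principle makes it constant.

For the main point regard W as a real space V of dimension n. For a nonzero linear M : V → V,
mollify t ↦ Φ(z, M t) by a fixed bump, take the gradients at n points, and let Θ(z, M) be their
determinant. Θ is holomorphic in z, continuous for M ≠ 0, unchanged when M is scaled, and satisfies
Θ(γz, ρ(γ)M) = Θ(z, M). It vanishes for singular M, since Φ(z, M ·) is then invariant under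
translation by a kernel vector. By cocompactness |Θ| has a global maximum at some (z₀, M₀), and by
the maximum principle Θ(·, M₀) is constant. By equivariance Θ(z₀, ρ(γ)M₀) has the same value for
every γ. Normalized powers of a proximal element have a nonzero singular limit A
(`exists_tendsto_singular_of_isProximal`), so this value is Θ(z₀, A M₀) = 0. Hence Θ = 0 identically
(`IsHomogeneousFamily.eq_of_tendsto_singular`).

Taking M = id, all gradients of the mollification of Φ(z, ·) lie in one complex hyperplane.
Liouville's theorem then gives a real direction of invariance, and homogeneity at infinity forces
Φ(z, ·) to be constant (`eq_of_det_mollifiedGradient_eq_zero`). -/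

theorem differentiableAt_integral_of_norm_le {E : Type*} [NormedAddCommGroup E] [NormedSpace ℂ E]
    [FiniteDimensional ℂ E] {α : Type*} [MeasurableSpace α] {μ : MeasureTheory.Measure α}
    {F : E → α → ℂ} {bound : α → ℝ} {c : E} {R : ℝ} (hR : 0 < R)
    (hd : ∀ t, DifferentiableOn ℂ (fun z => F z t) (Metric.ball c R))
    (hm : ∀ z ∈ Metric.ball c R, MeasureTheory.AEStronglyMeasurable (F z) μ)
    (hb : ∀ z ∈ Metric.ball c R, ∀ t, ‖F z t‖ ≤ bound t)
    (hbi : MeasureTheory.Integrable bound μ) :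
    DifferentiableAt ℂ (fun z => ∫ t, F z t ∂μ) c := by
  have hsub : ∀ x ∈ Metric.ball c (R / 2), Metric.ball x (R / 2) ⊆ Metric.ball c R := by
    intro x hx
    refine Metric.ball_subset_ball' ?_
    rw [Metric.mem_ball] at hx
    linarith
  have hc : c ∈ Metric.ball c R := Metric.mem_ball_self hR
  have hderiv : ∀ t, ∀ x ∈ Metric.ball c (R / 2),
      HasFDerivAt (fun z => F z t) (fderiv ℂ (fun z => F z t) x) x := fun t x hx =>
    ((hd t).differentiableAt (Metric.isOpen_ball.mem_nhds
      (hsub x hx (Metric.mem_ball_self (by linarith))))).hasFDerivAt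
  have hmeas : ∀ v : E, MeasureTheory.AEStronglyMeasurable
      (fun t => fderiv ℂ (fun z => F z t) c v) μ := by
    intro v
    have hlim : Filter.Tendsto (fun n : ℕ => c + ((n : ℂ))⁻¹ • v) Filter.atTop (nhds c) := by
      have h := (tendsto_inv_atTop_nhds_zero_nat (𝕜 := ℂ)).smul_const v
      simpa using h.const_add c
    obtain ⟨n₀, hn₀⟩ := Filter.eventually_atTop.1
      (hlim.eventually (Metric.ball_mem_nhds c hR))
    -- The derivative along `v` is a pointwise limit of difference quotients; the shift by `n₀`
    -- keeps the points c + v/n in the ball where `hm` applies.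
    refine aestronglyMeasurable_of_tendsto_ae (Filter.atTop (α := ℕ))
      (f := fun n t => ((n + n₀ : ℕ) : ℂ) • (F (c + ((n + n₀ : ℕ) : ℂ)⁻¹ • v) t - F c t))
      (fun n => by
        have h := ((hm _ (hn₀ (n + n₀) (Nat.le_add_left _ _))).sub (hm c hc)).const_smul
          ((n + n₀ : ℕ) : ℂ)
        exact h)
      (Filter.Eventually.of_forall fun t => ?_)
    have h := (hderiv t c (Metric.mem_ball_self (by linarith))).lim v
      (c := fun n : ℕ => (n : ℂ)) (l := Filter.atTop) ?_
    · exact h.comp (Filter.tendsto_add_atTop_nat n₀)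
    · simpa using tendsto_natCast_atTop_atTop (R := ℝ)
  have hmeas' : MeasureTheory.AEStronglyMeasurable (fun t => fderiv ℂ (fun z => F z t) c) μ := by
    let b := Module.finBasis ℂ E
    have key : (fun t => fderiv ℂ (fun z => F z t) c) = fun t => ∑ i,
        fderiv ℂ (fun z => F z t) c (b i) • (LinearMap.toContinuousLinearMap (b.coord i)) := by
      funext t
      refine ContinuousLinearMap.ext fun x => ?_
      conv_lhs => rw [← b.sum_repr x, map_sum]
      simp [mul_comm]
    rw [key]
    refine Finset.aestronglyMeasurable_fun_sum _ fun i _ => ?_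
    exact (hmeas (b i)).smul_const _
  refine (hasFDerivAt_integral_of_dominated_of_fderiv_le (𝕜 := ℂ)
    -- Cauchy estimate on the ball of radius R/2 about x, where F(·, t) stays within 2 * `bound t`
    -- of F(x, t).
    (bound := fun t => 2 * bound t / (R / 2))
    (F' := fun x t => fderiv ℂ (fun z => F z t) x)
    (Metric.ball_mem_nhds c (half_pos hR))
    (Filter.eventually_of_mem (Metric.ball_mem_nhds c hR) hm) ?_ hmeas' ?_ ?_ ?_).differentiableAt
  · exact hbi.mono' (hm c hc) (Filter.Eventually.of_forall (hb c hc))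
  · refine Filter.Eventually.of_forall fun t x hx => ?_
    refine Complex.norm_fderiv_le_div_of_mapsTo_ball ((hd t).mono (hsub x hx)) ?_ (half_pos hR)
    intro y hy
    rw [mem_closedBall_iff_norm]
    have h1 := hb y (hsub x hx hy) t
    have h2 := hb x (hsub x hx (Metric.mem_ball_self (half_pos hR))) t
    exact (norm_sub_le _ _).trans (by linarith)
  · exact (hbi.const_mul 2).div_const _
  · exact Filter.Eventually.of_forall hderiv

theorem mdifferentiable_integral_of_norm_le {E : Type*} [NormedAddCommGroup E] [NormedSpace ℂ E]
    [FiniteDimensional ℂ E] {T : Type*} [TopologicalSpace T] [ChartedSpace E T]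
    [IsManifold 𝓘(ℂ, E) ω T] {α : Type*} [MeasurableSpace α] {μ : MeasureTheory.Measure α}
    {F : T → α → ℂ} {bound : α → ℝ}
    (hd : ∀ t, MDifferentiable 𝓘(ℂ, E) 𝓘(ℂ, ℂ) (fun z => F z t))
    (hm : ∀ z, MeasureTheory.AEStronglyMeasurable (F z) μ)
    (hb : ∀ z t, ‖F z t‖ ≤ bound t) (hbi : MeasureTheory.Integrable bound μ)
    (hc : Continuous fun z => ∫ t, F z t ∂μ) :
    MDifferentiable 𝓘(ℂ, E) 𝓘(ℂ, ℂ) (fun z => ∫ t, F z t ∂μ) := by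
  intro z
  rw [mdifferentiableAt_iff]
  refine ⟨hc.continuousAt, ?_⟩
  simp only [mfld_simps, differentiableWithinAt_univ]
  obtain ⟨R, hR, hball⟩ := Metric.isOpen_iff.1 (chartAt E z).open_target _
    (mem_chart_target E z)
  refine differentiableAt_integral_of_norm_le (F := fun x t => F ((chartAt E z).symm x) t) hR
    (fun t x hx => ?_) (fun x _ => hm _) (fun x _ t => hb _ t) hbi
  have h1 : MDifferentiableAt 𝓘(ℂ, E) 𝓘(ℂ, E) (chartAt E z).symm x :=
    mdifferentiableAt_atlas_symm (I := 𝓘(ℂ, E)) (chart_mem_atlas E z) (hball hx)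
  have h2 := (hd t ((chartAt E z).symm x)).comp x h1
  exact (mdifferentiableAt_iff_differentiableAt.1 h2).differentiableWithinAt

/-! ## The maximum principle -/

theorem eq_of_norm_le_of_mdifferentiable {E : Type*} [NormedAddCommGroup E] [NormedSpace ℂ E]
    {T : Type*} [TopologicalSpace T] [PreconnectedSpace T] [ChartedSpace E T]
    [IsManifold 𝓘(ℂ, E) ω T] {h : T → ℂ} (hd : MDifferentiable 𝓘(ℂ, E) 𝓘(ℂ, ℂ) h)
    {c : T} (hmax : ∀ z, ‖h z‖ ≤ ‖h c‖) (z : T) : h z = h c := by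
  have : IsManifold 𝓘(ℂ, E) 1 T := IsManifold.of_le (n := ω) le_top
  exact (hd.mdifferentiableOn (s := Set.univ)).eqOn_of_isPreconnected_of_isMaxOn_norm
    isPreconnected_univ isOpen_univ (Set.mem_univ c) (fun z _ => hmax z) (Set.mem_univ z)

theorem mdifferentiable_det {E : Type*} [NormedAddCommGroup E] [NormedSpace ℂ E]
    {T : Type*} [TopologicalSpace T] [ChartedSpace E T] {n : Type*} [Fintype n] [DecidableEq n]
    {A : T → n → n → ℂ} (hA : ∀ i j, MDifferentiable 𝓘(ℂ, E) 𝓘(ℂ, ℂ) fun z => A z i j) :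
    MDifferentiable 𝓘(ℂ, E) 𝓘(ℂ, ℂ) fun z => (Matrix.of (A z)).det := by
  intro z
  have h1 : DifferentiableAt ℂ (fun B : n → n → ℂ => (Matrix.of B).det) (A z) := by
    simp only [Matrix.det_apply, Matrix.of_apply, Units.smul_def, zsmul_eq_mul]
    fun_prop
  have h2 : MDifferentiableAt 𝓘(ℂ, E) 𝓘(ℂ, n → n → ℂ) A z := by
    rw [mdifferentiableAt_iff]
    refine ⟨continuousAt_pi.2 fun i => continuousAt_pi.2 fun j => (hA i j z).continuousAt, ?_⟩
    refine differentiableWithinAt_pi.2 fun i => differentiableWithinAt_pi.2 fun j => ?_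
    exact ((mdifferentiableAt_iff _ _).1 (hA i j z)).2
  exact MDifferentiableAt.comp (M' := n → n → ℂ) (f := A)
    (g := fun B : n → n → ℂ => (Matrix.of B).det) z h1.mdifferentiableAt h2

theorem firstCountableTopology_of_chartedSpace (H : Type*) [TopologicalSpace H]
    [FirstCountableTopology H] (M : Type*) [TopologicalSpace M] [ChartedSpace H M] :
    FirstCountableTopology M :=
  ⟨fun x => by
    rw [← (chartAt H x).symm_map_nhds_eq (mem_chart_source H x)]
    infer_instance⟩

/-! ## Bounded functions whose mollified gradients are degenerate -/

theorem integral_smul_sub_add_eq {V : Type*} [NormedAddCommGroup V] [MeasurableSpace V]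
    [BorelSpace V] {μ : MeasureTheory.Measure V} [μ.IsAddHaarMeasure] {h : V → ℂ} {k : V → ℝ} {v : V}
    (hv : ∀ t, h (t + v) = h t)
    (s : V) : ∫ t, k (s + v - t) • h t ∂μ = ∫ t, k (s - t) • h t ∂μ := by
  rw [← MeasureTheory.integral_add_right_eq_self (fun t => k (s + v - t) • h t) v]
  simp [hv]

/-- If the vectors `g i` spanned, some of them would form a basis, with nonzero determinant. So a
nonzero linear functional kills them all. -/
theorem exists_dotProduct_eq_zero {n ι : Type*} [Fintype n] [DecidableEq n] (g : ι → n → ℂ)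
    (hg : ∀ s : n → ι, (Matrix.of fun i => g (s i)).det = 0) :
    ∃ v : n → ℂ, v ≠ 0 ∧ ∀ i, ∑ j, g i j * v j = 0 := by
  by_cases hspan : Submodule.span ℂ (Set.range g) = ⊤
  · exfalso
    obtain ⟨f, hf, -, hli⟩ := Submodule.exists_fun_fin_finrank_span_eq ℂ (Set.range g)
    have hcard : Module.finrank ℂ (Submodule.span ℂ (Set.range g)) = Fintype.card n := by
      rw [hspan, finrank_top, Module.finrank_fintype_fun_eq_card]
    let e : n ≃ Fin (Module.finrank ℂ (Submodule.span ℂ (Set.range g))) :=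
      (Fintype.equivFin n).trans (finCongr hcard.symm)
    choose s hs using hf
    have h1 : LinearIndependent ℂ fun i => g (s (e i)) := by
      simp only [hs]
      exact hli.comp e e.injective
    have h2 := (Matrix.linearIndependent_rows_iff_isUnit (A := Matrix.of fun i => g (s (e i)))).1 h1
    rw [Matrix.isUnit_iff_isUnit_det, hg fun i => s (e i)] at h2
    exact not_isUnit_zero h2
  · obtain ⟨φ, hφ, hle⟩ := Submodule.exists_le_ker_of_lt_top _ (lt_top_iff_ne_top.2 hspan)
    refine ⟨fun j => φ (Pi.single j 1), fun h0 => hφ ?_, fun i => ?_⟩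
    · refine LinearMap.pi_ext' fun j => LinearMap.ext_ring ?_
      simpa using congrFun h0 j
    · have h1 : φ (g i) = 0 := hle (Submodule.subset_span ⟨i, rfl⟩)
      rw [LinearMap.pi_apply_eq_sum_univ φ (g i)] at h1
      refine (Finset.sum_congr rfl fun j _ => ?_).trans h1
      rw [smul_eq_mul]
      refine congrArg _ (congrArg φ (funext fun l => ?_))
      simp [Pi.single_apply, eq_comm]

/-- Liouville's theorem for functions annihilated by a constant complex vector field. -/
theorem add_smul_eq_of_fderiv_add_I_mul_eq_zero {V : Type*} [NormedAddCommGroup V]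
    [NormedSpace ℝ V] {φ : V → ℂ} {C : ℝ} (hφ : Differentiable ℝ φ)
    (hb : ∀ s, ‖φ s‖ ≤ C) {u w : V} (h0 : ∀ s, fderiv ℝ φ s u + Complex.I * fderiv ℝ φ s w = 0)
    (s : V) (r : ℝ) : φ (s + r • u) = φ s ∧ φ (s + r • w) = φ s := by
  -- Along ζ ↦ s + Re ζ • u + Im ζ • w the hypothesis `h0` is the Cauchy–Riemann equation.
  let A : ℂ →L[ℝ] V := Complex.reCLM.smulRight u + Complex.imCLM.smulRight w
  have hA : ∀ ζ, HasFDerivAt (fun ζ : ℂ => φ (s + A ζ)) ((fderiv ℝ φ (s + A ζ)).comp A) ζ := by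
    intro ζ
    exact (hφ (s + A ζ)).hasFDerivAt.comp ζ (A.hasFDerivAt.const_add s)
  have hdiff : Differentiable ℂ fun ζ : ℂ => φ (s + A ζ) := by
    intro ζ
    refine differentiableAt_complex_iff_differentiableAt_real.2 ⟨(hA ζ).differentiableAt, ?_⟩
    have h1 := h0 (s + A ζ)
    rw [(hA ζ).fderiv]
    simp only [ContinuousLinearMap.comp_apply, A, add_apply,
      ContinuousLinearMap.smulRight_apply, Complex.reCLM_apply, Complex.imCLM_apply, Complex.I_re,
      Complex.I_im, Complex.one_re, Complex.one_im, zero_smul, one_smul, zero_add, add_zero,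
      smul_eq_mul] at h1 ⊢
    linear_combination (-Complex.I) * h1 + fderiv ℝ φ _ w * Complex.I_mul_I
  have hbdd : Bornology.IsBounded (Set.range fun ζ : ℂ => φ (s + A ζ)) :=
    isBounded_iff_forall_norm_le.2 ⟨C, by rintro _ ⟨ζ, rfl⟩; exact hb _⟩
  constructor
  · simpa [A] using hdiff.apply_eq_apply_of_bounded hbdd (r : ℂ) 0
  · simpa [A] using hdiff.apply_eq_apply_of_bounded hbdd ((r : ℂ) * Complex.I) 0

section Gradient

variable {V : Type*} [NormedAddCommGroup V] [NormedSpace ℝ V] [FiniteDimensional ℝ V]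
  [MeasurableSpace V] [BorelSpace V] {μ : MeasureTheory.Measure V} [μ.IsAddHaarMeasure]

/-- The derivative of a mollification of a bounded function. -/
theorem hasFDerivAt_integral_smul_sub {h : V → ℂ} {C : ℝ} (hm : Measurable h)
    (hb : ∀ t, ‖h t‖ ≤ C) {k : V → ℝ} (hk : ContDiff ℝ 1 k) (hks : HasCompactSupport k) (s : V) :
    ∃ D : V →L[ℝ] ℂ, HasFDerivAt (fun s => ∫ t, k (s - t) • h t ∂μ) D s ∧
      ∀ v, D v = ∫ t, fderiv ℝ k (s - t) v • h t ∂μ := by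
  have hl : MeasureTheory.LocallyIntegrable h μ := by
    rw [MeasureTheory.locallyIntegrable_iff]
    intro K hK
    exact MeasureTheory.Measure.integrableOn_of_bounded hK.measure_lt_top.ne
      hm.aestronglyMeasurable (Filter.Eventually.of_forall hb)
  refine ⟨_, hks.hasFDerivAt_convolution_right
    (ContinuousLinearMap.lsmul ℝ ℝ (E := ℂ)).flip hl hk s, fun v => ?_⟩
  rw [MeasureTheory.convolution_precompR_apply _ hl (hks.fderiv ℝ)
    (hk.continuous_fderiv one_ne_zero)]
  rfl

/-- The gradients, in the basis `b`, at the points `s i` of the mollification of `h` by `k`. -/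
noncomputable def mollifiedGradient {n : Type*} (μ : MeasureTheory.Measure V) (b : n → V)
    (k : V → ℝ)
    (h : V → ℂ) (s : n → V) (i j : n) : ℂ :=
  ∫ t, fderiv ℝ k (s i - t) (b j) • h t ∂μ

/-- The mollification inherits the invariance along `v`, so the real coordinates of `v` form a
kernel vector of the gradient matrix. -/
theorem det_mollifiedGradient_eq_zero {n : Type*} [Fintype n] [DecidableEq n]
    (b : Module.Basis n ℝ V) {h : V → ℂ} {C : ℝ} (hm : Measurable h) (hb : ∀ t, ‖h t‖ ≤ C)
    {k : V → ℝ} (hk : ContDiff ℝ 1 k) (hks : HasCompactSupport k) {v : V} (hv0 : v ≠ 0)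
    (hv : ∀ (r : ℝ) (t : V), h (t + r • v) = h t) (s : n → V) :
    (Matrix.of (mollifiedGradient μ b k h s)).det = 0 := by
  refine Matrix.exists_mulVec_eq_zero_iff.1 ⟨fun j => (b.repr v j : ℂ), ?_, ?_⟩
  · intro h0
    refine hv0 (b.repr.map_eq_zero_iff.1 (Finsupp.ext fun j => ?_))
    simpa using congrFun h0 j
  · funext i
    obtain ⟨D, hD, hD'⟩ := hasFDerivAt_integral_smul_sub (μ := μ) hm hb hk hks (s i)
    have h0 : D v = 0 := by
      have h1 := hD.hasLineDerivAt v
      have h2 : HasLineDerivAt ℝ (fun s => ∫ t, k (s - t) • h t ∂μ) 0 (s i) v := by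
        unfold HasLineDerivAt
        have : (fun r : ℝ => ∫ t, k (s i + r • v - t) • h t ∂μ) =
            fun _ => ∫ t, k (s i - t) • h t ∂μ :=
          funext fun r => integral_smul_sub_add_eq (hv r) _
        rw [this]
        exact hasDerivAt_const _ _
      exact HasDerivAt.unique h1 h2
    rw [← b.sum_repr v, map_sum] at h0
    simp only [Matrix.mulVec, dotProduct, Matrix.of_apply, Pi.zero_apply, mollifiedGradient]
    rw [← h0]
    refine Finset.sum_congr rfl fun j _ => ?_
    rw [← hD', map_smul, Complex.real_smul, mul_comm]

/-- After reflecting the variable, h(s + r e - t) = h(e + (s - t)/r) tends to h(e) by homogeneity,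
and dominated convergence applies. -/
theorem tendsto_integral_smul_sub_smul {h : V → ℂ} {C : ℝ} (hm : Measurable h)
    (hb : ∀ t, ‖h t‖ ≤ C) (hc : ContinuousOn h {0}ᶜ)
    (hs : ∀ (r : ℝ) (t : V), r ≠ 0 → h (r • t) = h t) {k : V → ℝ} (hk : Continuous k)
    (hks : HasCompactSupport k) (s : V) {e : V} (he : e ≠ 0) :
    Filter.Tendsto (fun r : ℝ => ∫ t, k (s + r • e - t) • h t ∂μ) Filter.atTop
      (nhds (∫ t, k t • h e ∂μ)) := by
  have h1 : ∀ r : ℝ, ∫ t, k (s + r • e - t) • h t ∂μ = ∫ t, k t • h (s + r • e - t) ∂μ := by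
    intro r
    rw [← MeasureTheory.integral_sub_left_eq_self (fun t => k t • h (s + r • e - t)) μ (s + r • e)]
    simp
  simp only [h1]
  refine MeasureTheory.tendsto_integral_filter_of_dominated_convergence (fun t => ‖k t‖ * C)
    (Filter.Eventually.of_forall fun r => ?_) (Filter.Eventually.of_forall fun r =>
      Filter.Eventually.of_forall fun t => ?_) ?_ (Filter.Eventually.of_forall fun t => ?_)
  · exact hk.aestronglyMeasurable.smul
      (hm.comp (measurable_const.sub measurable_id)).aestronglyMeasurable
  · rw [norm_smul]
    exact mul_le_mul_of_nonneg_left (hb _) (norm_nonneg _)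
  · exact (hk.integrable_of_hasCompactSupport hks).norm.mul_const C
  · refine Filter.Tendsto.const_smul ?_ _
    have h2 : Filter.Tendsto (fun r : ℝ => e + r⁻¹ • (s - t)) Filter.atTop (nhds e) := by
      simpa using ((tendsto_inv_atTop_zero (𝕜 := ℝ)).smul_const (s - t)).const_add e
    have h3 := (hc.continuousAt (isOpen_compl_singleton.mem_nhds he)).tendsto.comp h2
    refine h3.congr' ?_
    filter_upwards [Filter.eventually_gt_atTop (0 : ℝ)] with r hr
    rw [Function.comp_apply, ← hs r _ hr.ne', smul_add, smul_smul, mul_inv_cancel₀ hr.ne', one_smul]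
    congr 1
    abel

theorem eq_of_det_mollifiedGradient_eq_zero {n : Type*} [Fintype n] [DecidableEq n]
    (b : Module.Basis n ℝ V) {h : V → ℂ} {C : ℝ} (hm : Measurable h) (hb : ∀ t, ‖h t‖ ≤ C)
    (hc : ContinuousOn h {0}ᶜ) (hs : ∀ (r : ℝ) (t : V), r ≠ 0 → h (r • t) = h t)
    {k : V → ℝ} (hk : ContDiff ℝ 1 k) (hks : HasCompactSupport k) (hk0 : ∫ t, k t ∂μ ≠ 0)
    (hdet : ∀ s : n → V, (Matrix.of (mollifiedGradient μ b k h s)).det = 0)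
    {x y : V} (hx : x ≠ 0) (hy : y ≠ 0) : h x = h y := by
  obtain ⟨v, hv0, hv⟩ := exists_dotProduct_eq_zero
    (fun s j => ∫ t, fderiv ℝ k (s - t) (b j) • h t ∂μ) hdet
  set φ : V → ℂ := fun s => ∫ t, k (s - t) • h t ∂μ with hφ
  choose D hD hD' using hasFDerivAt_integral_smul_sub (μ := μ) hm hb hk hks
  have hφd : Differentiable ℝ φ := fun s => (hD s).differentiableAt
  have hφb : ∀ s, ‖φ s‖ ≤ ∫ t, ‖k t‖ * C ∂μ := by
    intro s
    have h1 : φ s = ∫ t, k t • h (s - t) ∂μ := by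
      rw [← MeasureTheory.integral_sub_left_eq_self (fun t => k t • h (s - t)) μ s]
      simp [hφ]
    rw [h1]
    refine MeasureTheory.norm_integral_le_of_norm_le
      ((hk.continuous.integrable_of_hasCompactSupport hks).norm.mul_const C)
      (Filter.Eventually.of_forall fun t => ?_)
    rw [norm_smul]
    exact mul_le_mul_of_nonneg_left (hb _) (norm_nonneg _)
  -- Real and imaginary parts of the complex direction `v` that annihilates all gradients; at least
  -- one of them is nonzero.
  let u : V := ∑ j, (v j).re • b j
  let w : V := ∑ j, (v j).im • b j
  have huw : ∀ s, fderiv ℝ φ s u + Complex.I * fderiv ℝ φ s w = 0 := by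
    intro s
    have hvs : ∑ j, D s (b j) * v j = 0 := by simpa only [hD'] using hv s
    rw [(hD s).fderiv, ← hvs]
    simp only [u, w, map_sum, map_smul, Complex.real_smul, Finset.mul_sum]
    rw [← Finset.sum_add_distrib]
    refine Finset.sum_congr rfl fun j _ => ?_
    conv_rhs => rw [← Complex.re_add_im (v j)]
    ring
  have hinv := add_smul_eq_of_fderiv_add_I_mul_eq_zero hφd hφb huw
  obtain ⟨e, he, hφe⟩ : ∃ e : V, e ≠ 0 ∧ ∀ (s : V) (r : ℝ), φ (s + r • e) = φ s := by
    by_cases hu : u = 0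
    · refine ⟨w, fun hw => hv0 (funext fun j => ?_), fun s r => (hinv s r).2⟩
      have hu' := Fintype.linearIndependent_iff.1 b.linearIndependent _ hu j
      have hw' := Fintype.linearIndependent_iff.1 b.linearIndependent _ hw j
      exact Complex.ext hu' hw'
    · exact ⟨u, hu, fun s r => (hinv s r).1⟩
  -- Invariance along `e` allows `s` to be moved to infinity in that direction without changing φ.
  have hconst : ∀ s, φ s = ∫ t, k t • h e ∂μ := fun s =>
    tendsto_nhds_unique (tendsto_const_nhds.congr fun r => (hφe s r).symm)
      (tendsto_integral_smul_sub_smul hm hb hc hs hk.continuous hks s he)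
  have hval : ∀ x : V, x ≠ 0 → h x = h e := by
    intro x hx
    have h1 := tendsto_integral_smul_sub_smul (μ := μ) hm hb hc hs hk.continuous hks 0 hx
    have h2 : ∫ t, k t • h x ∂μ = ∫ t, k t • h e ∂μ :=
      tendsto_nhds_unique h1 (tendsto_const_nhds.congr fun r => (hconst (0 + r • x)).symm)
    rw [integral_smul_const, integral_smul_const] at h2
    exact smul_right_injective ℂ hk0 h2
  rw [hval x hx, hval y hy]

end Gradient

/-! ## Homogeneous holomorphic families -/

section Family

/-- A bounded family of continuous functions on the projective space of the real vector space `V`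
that depends holomorphically on a parameter in the complex manifold `T`. -/
structure IsHomogeneousFamily (E : Type*) [NormedAddCommGroup E] [NormedSpace ℂ E]
    {T V : Type*} [TopologicalSpace T] [ChartedSpace E T] [NormedAddCommGroup V] [NormedSpace ℝ V]
    (Φ : T → V → ℂ) (C : ℝ) : Prop where
  continuousOn : ContinuousOn (fun q : T × V => Φ q.1 q.2) {q | q.2 ≠ 0}
  smul_eq : ∀ z (r : ℝ) w, r ≠ 0 → Φ z (r • w) = Φ z w
  norm_le : ∀ z w, ‖Φ z w‖ ≤ C
  mdifferentiable : ∀ w, MDifferentiable 𝓘(ℂ, E) 𝓘(ℂ, ℂ) fun z => Φ z w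

variable {E : Type*} [NormedAddCommGroup E] [NormedSpace ℂ E]
  {T : Type*} [TopologicalSpace T] [ChartedSpace E T]
  {V : Type*} [NormedAddCommGroup V] [NormedSpace ℝ V] {Φ : T → V → ℂ} {C : ℝ}

namespace IsHomogeneousFamily

theorem continuousOn_right (hΦ : IsHomogeneousFamily E Φ C) (z : T) :
    ContinuousOn (Φ z) {0}ᶜ :=
  hΦ.continuousOn.comp (f := fun w => (z, w)) (by fun_prop) fun _ hw => hw

section Measure

variable [MeasurableSpace V] [BorelSpace V]

theorem measurable (hΦ : IsHomogeneousFamily E Φ C) (z : T) : Measurable (Φ z) :=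
  measurable_of_continuousOn_compl_singleton 0 (hΦ.continuousOn_right z)

theorem measurable_comp (hΦ : IsHomogeneousFamily E Φ C) (z : T) (M : V →L[ℝ] V) :
    Measurable fun t => Φ z (M t) :=
  (hΦ.measurable z).comp M.continuous.measurable

variable [FiniteDimensional ℝ V] {μ : MeasureTheory.Measure V} [μ.IsAddHaarMeasure]

theorem continuousOn_integral [FiniteDimensional ℂ E] (hΦ : IsHomogeneousFamily E Φ C)
    {κ : V → ℝ} (hκ : Continuous κ) (hκs : HasCompactSupport κ) :
    ContinuousOn (fun q : T × (V →L[ℝ] V) => ∫ t, κ t • Φ q.1 (q.2 t) ∂μ) {q | q.2 ≠ 0} := by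
  have := firstCountableTopology_of_chartedSpace E T
  rintro ⟨z, M⟩ hM
  refine ContinuousAt.continuousWithinAt ?_
  refine MeasureTheory.continuousAt_of_dominated (bound := fun t => ‖κ t‖ * C)
    (Filter.Eventually.of_forall fun q => ?_) (Filter.Eventually.of_forall fun q =>
      Filter.Eventually.of_forall fun t => ?_) ?_ ?_
  · exact hκ.aestronglyMeasurable.smul (hΦ.measurable_comp q.1 q.2).aestronglyMeasurable
  · rw [norm_smul]
    exact mul_le_mul_of_nonneg_left (hΦ.norm_le _ _) (norm_nonneg _)
  · exact (hκ.integrable_of_hasCompactSupport hκs).norm.mul_const C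
  · have hker : μ (LinearMap.ker (M : V →ₗ[ℝ] V) : Set V) = 0 := by
      refine MeasureTheory.Measure.addHaar_submodule μ _ fun htop => hM ?_
      have h0 := LinearMap.ker_eq_top.1 htop
      exact ContinuousLinearMap.ext fun t => congrArg (fun f : V →ₗ[ℝ] V => f t) h0
    have hae : ∀ᵐ t ∂μ, M t ≠ 0 := by
      rw [MeasureTheory.ae_iff]
      convert hker using 2
      ext t
      simp
    filter_upwards [hae] with t ht
    refine ContinuousAt.const_smul ?_ (κ t)
    have h1 : ContinuousAt (fun q : T × V => Φ q.1 q.2) (z, M t) :=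
      hΦ.continuousOn.continuousAt ((isOpen_ne.preimage continuous_snd).mem_nhds ht)
    exact ContinuousAt.comp (f := fun q : T × (V →L[ℝ] V) => (q.1, q.2 t)) (x := (z, M)) h1
      (by fun_prop)

theorem mdifferentiable_integral [FiniteDimensional ℂ E] [IsManifold 𝓘(ℂ, E) ω T]
    (hΦ : IsHomogeneousFamily E Φ C)
    {κ : V → ℝ} (hκ : Continuous κ) (hκs : HasCompactSupport κ) {M : V →L[ℝ] V} (hM : M ≠ 0) :
    MDifferentiable 𝓘(ℂ, E) 𝓘(ℂ, ℂ) fun z => ∫ t, κ t • Φ z (M t) ∂μ := by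
  refine mdifferentiable_integral_of_norm_le (bound := fun t => ‖κ t‖ * C) (fun t => ?_)
    (fun z => ?_) (fun z t => ?_) ?_ ?_
  · have h := (hΦ.mdifferentiable (M t)).const_smul (κ t : ℂ)
    exact h
  · exact hκ.aestronglyMeasurable.smul (hΦ.measurable_comp z M).aestronglyMeasurable
  · rw [norm_smul]
    exact mul_le_mul_of_nonneg_left (hΦ.norm_le _ _) (norm_nonneg _)
  · exact (hκ.integrable_of_hasCompactSupport hκs).norm.mul_const C
  · exact (hΦ.continuousOn_integral hκ hκs).comp_continuous (f := fun z => (z, M)) (by fun_prop)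
      fun _ => hM

end Measure

/-- A homogeneous holomorphic family that is equivariant under a cocompact action does not depend
on the vector, if some limit of multiples of the linear parts of the action is singular. -/
theorem eq_of_tendsto_singular [FiniteDimensional ℝ V] [FiniteDimensional ℂ E]
    [IsManifold 𝓘(ℂ, E) ω T]
    [PreconnectedSpace T] [Nonempty T] (hΦ : IsHomogeneousFamily E Φ C) {G : Type*}
    (a : G → T → T) (ha : ∀ g, Function.Surjective (a g)) (l : G → V ≃L[ℝ] V)
    (hinv : ∀ g z w, Φ (a g z) (l g w) = Φ z w) {K : Set T} (hK : IsCompact K)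
    (hcov : ∀ z, ∃ g, a g z ∈ K) {A : V →L[ℝ] V} (hA0 : A ≠ 0) (hA : ¬ Function.Injective A)
    {g : ℕ → G} {c : ℕ → ℝ} (hc : ∀ j, c j ≠ 0)
    (hlim : Filter.Tendsto (fun j => c j • (l (g j) : V →L[ℝ] V)) Filter.atTop (nhds A))
    (z : T) {x y : V} (hx : x ≠ 0) (hy : y ≠ 0) : Φ z x = Φ z y := by
  let : MeasurableSpace V := borel V
  have : BorelSpace V := ⟨rfl⟩
  let μ : MeasureTheory.Measure V := MeasureTheory.Measure.addHaar
  let b := Module.finBasis ℝ V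
  let f : ContDiffBump (0 : V) := default
  have hf : ContDiff ℝ 1 f := f.contDiff
  have hfs : HasCompactSupport f := f.hasCompactSupport
  have hf' : Continuous (fderiv ℝ f) := hf.continuous_fderiv one_ne_zero
  have : Nontrivial V := ⟨x, 0, hx⟩
  refine eq_of_det_mollifiedGradient_eq_zero (μ := μ) b (hΦ.measurable z) (hΦ.norm_le z)
    (hΦ.continuousOn_right z) (hΦ.smul_eq z) hf hfs (f.integral_pos).ne' (fun s => ?_) hx hy
  -- The variable M ranges over all nonzero endomorphisms, so that singular limits of the group
  -- action stay in the domain of Θ.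
  let Θ : T → (V →L[ℝ] V) → ℂ := fun z M =>
    (Matrix.of (mollifiedGradient μ b f (fun t => Φ z (M t)) s)).det
  have hκ : ∀ i j, Continuous fun t => fderiv ℝ f (s i - t) (b j) := fun i j => by fun_prop
  have hκs : ∀ i j, HasCompactSupport fun t => fderiv ℝ f (s i - t) (b j) := fun i j =>
    ((hfs.fderiv_apply ℝ (b j)).comp_homeomorph (Homeomorph.subLeft (s i)) :)
  have hΘc : ContinuousOn (fun q : T × (V →L[ℝ] V) => Θ q.1 q.2) {q | q.2 ≠ 0} := by
    refine (continuous_id.matrix_det).comp_continuousOn ?_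
    exact continuousOn_pi.2 fun i => continuousOn_pi.2 fun j =>
      hΦ.continuousOn_integral (hκ i j) (hκs i j)
  have hΘd : ∀ M, M ≠ 0 → MDifferentiable 𝓘(ℂ, E) 𝓘(ℂ, ℂ) fun z => Θ z M := fun M hM =>
    mdifferentiable_det fun i j => hΦ.mdifferentiable_integral (hκ i j) (hκs i j) hM
  have hΘsmul : ∀ z (r : ℝ) M, r ≠ 0 → Θ z (r • M) = Θ z M := fun z r M hr => by
    simp only [Θ, smul_apply, hΦ.smul_eq z r _ hr]
  have hΘinv : ∀ g z (M : V →L[ℝ] V), Θ (a g z) ((l g : V →L[ℝ] V).comp M) = Θ z M :=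
    fun g z M => by simp [Θ, hinv]
  have hΘsing : ∀ z (M : V →L[ℝ] V), ¬ Function.Injective M → Θ z M = 0 := by
    intro z M hM
    obtain ⟨v, hv, hv0⟩ : ∃ v, M v = 0 ∧ v ≠ 0 := by
      rw [injective_iff_map_eq_zero] at hM
      push Not at hM
      exact hM
    refine det_mollifiedGradient_eq_zero b (hΦ.measurable_comp z M) (fun t => hΦ.norm_le _ _)
      hf hfs hv0 (fun r t => ?_) s
    simp [hv]
  have hl0 : ∀ g (M : V →L[ℝ] V), M ≠ 0 → (l g : V →L[ℝ] V).comp M ≠ 0 := by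
    intro g M hM h0
    refine hM (ContinuousLinearMap.ext fun t => (l g).injective ?_)
    simpa using congrArg (fun B : V →L[ℝ] V => B t) h0
  -- By equivariance and scale invariance a maximum over `K` times the unit sphere is a maximum over
  -- all z and all M ≠ 0.
  obtain ⟨⟨z₀, M₀⟩, ⟨-, hM₀⟩, hmax⟩ := (hK.prod (isCompact_sphere (0 : V →L[ℝ] V) 1)).exists_isMaxOn
    (f := fun q => ‖Θ q.1 q.2‖) (by
      obtain ⟨g₀, hg₀⟩ := hcov (Classical.arbitrary T)
      obtain ⟨M, hM⟩ := (NormedSpace.sphere_nonempty (x := (0 : V →L[ℝ] V)) (r := 1)).2 zero_le_one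
      exact ⟨(_, M), hg₀, hM⟩)
    (hΘc.norm.mono fun q hq => ne_zero_of_mem_unit_sphere (⟨q.2, hq.2⟩ : Metric.sphere _ _))
  have hM₀0 : M₀ ≠ 0 := ne_zero_of_mem_unit_sphere (⟨M₀, hM₀⟩ : Metric.sphere _ _)
  have hmax' : ∀ z M, M ≠ 0 → ‖Θ z M‖ ≤ ‖Θ z₀ M₀‖ := by
    intro z M hM
    obtain ⟨g, hg⟩ := hcov z
    have hN := hl0 g M hM
    rw [← hΘinv g, ← hΘsmul _ _ _ (inv_ne_zero (norm_ne_zero_iff.2 hN))]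
    refine hmax (Set.mk_mem_prod hg ?_)
    rw [mem_sphere_zero_iff_norm, norm_smul, norm_inv, norm_norm,
      inv_mul_cancel₀ (norm_ne_zero_iff.2 hN)]
  have hconst : ∀ z, Θ z M₀ = Θ z₀ M₀ :=
    eq_of_norm_le_of_mdifferentiable (hΘd M₀ hM₀0) fun z => hmax' z M₀ hM₀0
  have hzero : Θ z₀ M₀ = 0 := by
    by_cases hinj : Function.Injective M₀
    · have hsurj : Function.Surjective M₀ :=
        LinearMap.surjective_of_injective (f := (M₀ : V →ₗ[ℝ] V)) hinj
      have hAM : A.comp M₀ ≠ 0 := by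
        intro h0
        refine hA0 (ContinuousLinearMap.ext fun t => ?_)
        obtain ⟨t, rfl⟩ := hsurj t
        exact congrArg (fun B : V →L[ℝ] V => B t) h0
      have hAMs : ¬ Function.Injective (A.comp M₀) := by
        intro h
        refine hA fun p q hpq => ?_
        obtain ⟨p, rfl⟩ := hsurj p
        obtain ⟨q, rfl⟩ := hsurj q
        rw [h hpq]
      have h1 : ContinuousAt (fun q : T × (V →L[ℝ] V) => Θ q.1 q.2) (z₀, A.comp M₀) :=
        hΘc.continuousAt ((isOpen_ne.preimage continuous_snd).mem_nhds hAM)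
      have h2 : Filter.Tendsto (fun j => (z₀, (c j • (l (g j) : V →L[ℝ] V)).comp M₀)) Filter.atTop
          (nhds (z₀, A.comp M₀)) :=
        tendsto_const_nhds.prodMk_nhds
          (((ContinuousLinearMap.compL ℝ V V V).flip M₀).continuous.tendsto A |>.comp hlim)
      -- Writing z₀ as a (g j) z₁ moves the action from M₀ to the base point, where `hconst`
      -- applies.
      have h3 : ∀ j, Θ z₀ ((c j • (l (g j) : V →L[ℝ] V)).comp M₀) = Θ z₀ M₀ := by
        intro j
        obtain ⟨z₁, hz₁⟩ := ha (g j) z₀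
        rw [ContinuousLinearMap.smul_comp, hΘsmul _ _ _ (hc j), ← hz₁, hΘinv, hz₁]
        exact hconst z₁
      have h4 : Θ z₀ (A.comp M₀) = Θ z₀ M₀ :=
        tendsto_nhds_unique (h1.tendsto.comp h2) (tendsto_const_nhds.congr fun j => (h3 j).symm)
      rw [← h4]
      exact hΘsing _ _ hAMs
    · exact hΘsing _ _ hinj
  have h := hmax' z (ContinuousLinearMap.id ℝ V) (fun h0 => hx (by
    simpa using congrArg (fun B : V →L[ℝ] V => B x) h0))
  rw [hzero, norm_zero] at h
  exact norm_le_zero_iff.1 h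

end IsHomogeneousFamily

end Family

/-! ## Powers of proximal linear maps -/

section Proximal

theorem norm_rclikeToComplex {𝕜 : Type*} [RCLike 𝕜] (x : 𝕜) : ‖rclikeToComplex 𝕜 x‖ = ‖x‖ := by
  have h1 : ‖rclikeToComplex 𝕜 x‖ ^ 2 = ‖x‖ ^ 2 := by
    rw [Complex.sq_norm, Complex.normSq_apply, RCLike.norm_sq_eq_def (z := x)]
    rfl
  exact (sq_eq_sq₀ (norm_nonneg _) (norm_nonneg _)).1 h1

theorem log_norm_multiset_prod (s : Multiset ℂ) (hs : (0 : ℂ) ∉ s) :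
    Real.log ‖s.prod‖ = (s.map fun z => Real.log ‖z‖).sum := by
  induction s using Multiset.induction with
  | empty => simp
  | cons z s ih =>
    rw [Multiset.mem_cons, not_or] at hs
    have hp : s.prod ≠ 0 := Multiset.prod_ne_zero hs.2
    rw [Multiset.prod_cons, norm_mul, Real.log_mul (norm_ne_zero_iff.2 (Ne.symm hs.1))
      (norm_ne_zero_iff.2 hp), ih hs.2, Multiset.map_cons, Multiset.sum_cons]

/-- This is the only way simplicity of the top exponent enters: in dimension at least two, the mean
exponent is strictly below the maximum. -/
theorem sum_lt_card_mul_of_count_eq_one {s : Multiset ℝ} {a : ℝ} (hle : ∀ x ∈ s, x ≤ a)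
    (ha : a ∈ s) (hcount : s.count a = 1) (hcard : 2 ≤ s.card) : s.sum < s.card * a := by
  obtain ⟨t, rfl⟩ := Multiset.exists_cons_of_mem ha
  rw [Multiset.count_cons_self, Nat.add_eq_right, Multiset.count_eq_zero] at hcount
  rw [Multiset.card_cons] at hcard
  have ht : t ≠ ∅ := by
    rintro rfl
    simp at hcard
  have h1 : (t.map fun x => x).sum < (t.map fun _ => a).sum :=
    Multiset.sum_lt_sum_of_nonempty ht fun x hx =>
      lt_of_le_of_ne (hle x (Multiset.mem_cons_of_mem hx)) fun h => hcount (h ▸ hx)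
  simp only [Multiset.map_id', Multiset.map_const', Multiset.sum_replicate, nsmul_eq_mul] at h1
  rw [Multiset.sum_cons, Multiset.card_cons]
  push_cast
  linarith

variable {𝕜 : Type*} [RCLike 𝕜] {W : Type*} [NormedAddCommGroup W] [NormedSpace 𝕜 W]
  [FiniteDimensional 𝕜 W]

theorem map_charpoly_eq_charpoly_map_toMatrix (f : W →ₗ[𝕜] W) :
    f.charpoly.map (rclikeToComplex 𝕜) = ((LinearMap.toMatrix (Module.finBasis 𝕜 W)
      (Module.finBasis 𝕜 W) f).map (rclikeToComplex 𝕜)).charpoly := by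
  rw [Matrix.charpoly_map, LinearMap.charpoly_toMatrix]

/-- The powers of a linear map grow at least as fast as those of its eigenvalues. -/
theorem exists_norm_pow_le_mul_norm_pow (f : W →L[𝕜] W) {z : ℂ}
    (hz : z ∈ ((f : W →ₗ[𝕜] W).charpoly.map (rclikeToComplex 𝕜)).roots) :
    ∃ C : ℝ, 0 ≤ C ∧ ∀ m : ℕ, ‖z‖ ^ m ≤ C * ‖f ^ m‖ := by
  let b := Module.finBasis 𝕜 W
  let N := (LinearMap.toMatrix b b (f : W →ₗ[𝕜] W)).map (rclikeToComplex 𝕜)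
  have hroot := (Polynomial.mem_roots'.1 hz).2
  rw [map_charpoly_eq_charpoly_map_toMatrix, Polynomial.IsRoot, Matrix.eval_charpoly] at hroot
  -- `z` need not lie in `𝕜`, so the eigenvector is taken for the complexified matrix; a nonzero
  -- coordinate of it bounds ‖z‖ ^ m by the entries of the matrix of f ^ m.
  obtain ⟨v, hv0, hv⟩ := Matrix.exists_mulVec_eq_zero_iff.2 hroot
  have hNv : N.mulVec v = z • v := by
    rw [Matrix.sub_mulVec, sub_eq_zero] at hv
    rw [show N.mulVec v = _ from hv.symm]
    simp
  have hpow : ∀ m : ℕ, (N ^ m).mulVec v = z ^ m • v := by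
    intro m
    induction m with
    | zero => simp
    | succ m ih =>
      rw [pow_succ, ← Matrix.mulVec_mulVec, hNv, Matrix.mulVec_smul, ih, smul_smul, pow_succ']
  have hNpow : ∀ m : ℕ, N ^ m = (LinearMap.toMatrix b b ((f ^ m : W →L[𝕜] W) : W →ₗ[𝕜] W)).map
      (rclikeToComplex 𝕜) := by
    intro m
    rw [ContinuousLinearMap.toLinearMap_pow, ← LinearMap.toMatrix_pow, Matrix.map_pow]
  obtain ⟨i, hi⟩ := Function.ne_iff.1 hv0
  have hi' : 0 < ‖v i‖ := norm_pos_iff.2 hi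
  let c : W →L[𝕜] 𝕜 := LinearMap.toContinuousLinearMap (b.coord i)
  refine ⟨(∑ j, ‖c‖ * ‖b j‖ * ‖v j‖) / ‖v i‖, by positivity, fun m => ?_⟩
  rw [div_mul_eq_mul_div, le_div_iff₀ hi', ← norm_pow, ← norm_mul]
  have h1 : z ^ m * v i = ∑ j, (N ^ m) i j * v j := by
    have := congrFun (hpow m) i
    rw [Pi.smul_apply, smul_eq_mul] at this
    rw [← this]
    rfl
  rw [h1, Finset.sum_mul]
  refine (norm_sum_le _ _).trans (Finset.sum_le_sum fun j _ => ?_)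
  rw [norm_mul, hNpow, Matrix.map_apply, norm_rclikeToComplex, LinearMap.toMatrix_apply]
  have h2 : ‖c ((f ^ m) (b j))‖ ≤ ‖c‖ * (‖f ^ m‖ * ‖b j‖) :=
    (c.le_opNorm _).trans (mul_le_mul_of_nonneg_left ((f ^ m).le_opNorm _) (norm_nonneg _))
  calc ‖c ((f ^ m) (b j))‖ * ‖v j‖ ≤ ‖c‖ * (‖f ^ m‖ * ‖b j‖) * ‖v j‖ :=
        mul_le_mul_of_nonneg_right h2 (norm_nonneg _)
    _ = ‖c‖ * ‖b j‖ * ‖v j‖ * ‖f ^ m‖ := by ring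

/-- The characteristic exponents sum to log |det g|, which is less than the dimension times the
maximal exponent. -/
theorem exists_root_log_norm_det_lt {g : LinearMap.GeneralLinearGroup 𝕜 W} (hg : IsProximal g)
    (hW : 2 ≤ Module.finrank 𝕜 W) :
    ∃ z ∈ ((g : W →ₗ[𝕜] W).charpoly.map (rclikeToComplex 𝕜)).roots, z ≠ 0 ∧
      ‖LinearMap.det (g : W →ₗ[𝕜] W)‖ < ‖z‖ ^ Module.finrank 𝕜 W := by
  obtain ⟨a, ha, hle, hcount⟩ := hg
  have hdet0 : LinearMap.det (g : W →ₗ[𝕜] W) ≠ 0 :=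
    (LinearMap.isUnit_det _ g.isUnit).ne_zero
  have hprod : rclikeToComplex 𝕜 (LinearMap.det (g : W →ₗ[𝕜] W)) =
      ((g : W →ₗ[𝕜] W).charpoly.map (rclikeToComplex 𝕜)).roots.prod := by
    rw [map_charpoly_eq_charpoly_map_toMatrix, ← Matrix.det_eq_prod_roots_charpoly,
      ← LinearMap.det_toMatrix (Module.finBasis 𝕜 W), RingHom.map_det]
    rfl
  have hcard : ((g : W →ₗ[𝕜] W).charpoly.map (rclikeToComplex 𝕜)).roots.card =
      Module.finrank 𝕜 W := by
    rw [IsAlgClosed.card_roots_eq_natDegree, Polynomial.natDegree_map, LinearMap.charpoly_natDegree]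
  have h0 : (0 : ℂ) ∉ ((g : W →ₗ[𝕜] W).charpoly.map (rclikeToComplex 𝕜)).roots := by
    intro h0
    rw [Multiset.prod_eq_zero h0, map_eq_zero] at hprod
    exact hdet0 hprod
  have hsum := sum_lt_card_mul_of_count_eq_one hle ha hcount (by
    rw [characteristicExponents, Multiset.card_map, hcard]; exact hW)
  rw [characteristicExponents, ← log_norm_multiset_prod _ h0, Multiset.card_map, hcard, ← hprod,
    norm_rclikeToComplex] at hsum
  obtain ⟨z, hz, rfl⟩ := Multiset.mem_map.1 ha
  have hz0 : z ≠ 0 := fun h => h0 (h ▸ hz)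
  refine ⟨z, hz, hz0, ?_⟩
  rw [← Real.log_pow] at hsum
  exact (Real.log_lt_log_iff (norm_pos_iff.2 hdet0) (pow_pos (norm_pos_iff.2 hz0) _)).1 hsum

/-- The normalized powers of a proximal linear map of a space of dimension at least two have a
singular limit point. -/
theorem exists_tendsto_singular_of_isProximal {g : LinearMap.GeneralLinearGroup 𝕜 W}
    (hg : IsProximal g) (hW : 2 ≤ Module.finrank 𝕜 W) :
    ∃ A : W →L[𝕜] W, A ≠ 0 ∧ ¬ Function.Injective A ∧ ∃ (m : ℕ → ℕ) (c : ℕ → ℝ), (∀ j, c j ≠ 0) ∧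
      Filter.Tendsto (fun j => (c j : 𝕜) • LinearMap.toContinuousLinearMap
        ((g ^ m j : LinearMap.GeneralLinearGroup 𝕜 W) : W →ₗ[𝕜] W)) Filter.atTop (nhds A) := by
  have : Nontrivial W := Module.nontrivial_of_finrank_pos (R := 𝕜) (by omega)
  let f : W →L[𝕜] W := LinearMap.toContinuousLinearMap (g : W →ₗ[𝕜] W)
  have hfm : ∀ m : ℕ, LinearMap.toContinuousLinearMap
      ((g ^ m : LinearMap.GeneralLinearGroup 𝕜 W) : W →ₗ[𝕜] W) = f ^ m := by
    intro m
    refine ContinuousLinearMap.coe_injective ?_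
    rw [ContinuousLinearMap.toLinearMap_pow]
    simp [f]
  have hfm0 : ∀ m : ℕ, 0 < ‖f ^ m‖ := by
    intro m
    rw [norm_pos_iff, ← hfm]
    intro h0
    obtain ⟨w, hw⟩ := exists_ne (0 : W)
    have h1 := congrArg (fun B : W →L[𝕜] W => B w) h0
    have h2 : (g ^ m) • w = 0 := h1
    exact hw ((smul_eq_zero_iff_eq (g ^ m)).1 h2)
  obtain ⟨z, hz, hz0, hdet⟩ := exists_root_log_norm_det_lt hg hW
  obtain ⟨C, hC, hbound⟩ := exists_norm_pow_le_mul_norm_pow f hz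
  have : ProperSpace (W →L[𝕜] W) := FiniteDimensional.proper_rclike 𝕜 _
  have hsphere : ∀ m : ℕ, ((‖f ^ m‖⁻¹ : ℝ) : 𝕜) • f ^ m ∈ Metric.sphere (0 : W →L[𝕜] W) 1 := by
    intro m
    rw [mem_sphere_zero_iff_norm, norm_smul, RCLike.norm_ofReal, abs_inv, abs_norm,
      inv_mul_cancel₀ (hfm0 m).ne']
  obtain ⟨A, hA, m, hm, hlim⟩ := (isCompact_sphere (0 : W →L[𝕜] W) 1).tendsto_subseq hsphere
  refine ⟨A, ne_zero_of_mem_unit_sphere (⟨A, hA⟩ : Metric.sphere _ _), ?_, m,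
    fun j => ‖f ^ m j‖⁻¹, fun j => inv_ne_zero (hfm0 _).ne', ?_⟩
  · have hdetlim : Filter.Tendsto (fun j => LinearMap.det
        ((((‖f ^ m j‖⁻¹ : ℝ) : 𝕜) • f ^ m j : W →L[𝕜] W) : W →ₗ[𝕜] W)) Filter.atTop
        (nhds (LinearMap.det (A : W →ₗ[𝕜] W))) :=
      (ContinuousLinearMap.continuous_det.tendsto A).comp hlim
    have hz' : 0 < ‖z‖ := norm_pos_iff.2 hz0
    set n := Module.finrank 𝕜 W
    -- By `hbound`, ‖f ^ k‖⁻¹ ≤ C / ‖z‖ ^ k, so the determinants of the normalized powers decay at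
    -- least like q ^ k, and the limit `A` is singular.
    set q : ℝ := ‖LinearMap.det (g : W →ₗ[𝕜] W)‖ / ‖z‖ ^ n with hq
    have hq1 : q < 1 := (div_lt_one (pow_pos hz' n)).2 hdet
    have hq0 : 0 ≤ q := by positivity
    have hdetle : ∀ k : ℕ, ‖LinearMap.det
        ((((‖f ^ k‖⁻¹ : ℝ) : 𝕜) • f ^ k : W →L[𝕜] W) : W →ₗ[𝕜] W)‖ ≤ C ^ n * q ^ k := by
      intro k
      rw [ContinuousLinearMap.toLinearMap_smul, LinearMap.det_smul,
        ContinuousLinearMap.toLinearMap_pow, map_pow, norm_mul,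
        norm_pow (((‖f ^ k‖⁻¹ : ℝ) : 𝕜)), norm_pow (LinearMap.det _),
        RCLike.norm_ofReal, abs_inv, abs_norm]
      have h1 : ‖f ^ k‖⁻¹ ≤ C / ‖z‖ ^ k := by
        rw [inv_eq_one_div, div_le_div_iff₀ (hfm0 k) (pow_pos hz' k), one_mul]
        exact hbound k
      calc (‖f ^ k‖⁻¹) ^ n * ‖LinearMap.det (g : W →ₗ[𝕜] W)‖ ^ k
          ≤ (C / ‖z‖ ^ k) ^ n * ‖LinearMap.det (g : W →ₗ[𝕜] W)‖ ^ k :=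
            mul_le_mul_of_nonneg_right
              (pow_le_pow_left₀ (inv_nonneg.2 (norm_nonneg _)) h1 n) (by positivity)
        _ = C ^ n * q ^ k := by
            rw [hq, div_pow, div_pow, ← pow_mul, ← pow_mul, mul_comm k n]
            ring
    have hdet0 : LinearMap.det (A : W →ₗ[𝕜] W) = 0 := by
      refine tendsto_nhds_unique hdetlim (squeeze_zero_norm (fun j => hdetle (m j)) ?_)
      have h1 := ((tendsto_pow_atTop_nhds_zero_of_lt_one hq0 hq1).comp
        hm.tendsto_atTop).const_mul (C ^ n)
      simpa using h1
    intro hinj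
    have hu := LinearMap.isUnit_iff_ker_eq_bot (A : W →ₗ[𝕜] W) |>.2 (LinearMap.ker_eq_bot.2 hinj)
    exact (LinearMap.isUnit_det _ hu).ne_zero hdet0
  · simp only [hfm]
    exact hlim

end Proximal

/-! ## Covering maps -/

section Covering

theorem IsCoveringMap.isClosed_range {T S : Type*} [TopologicalSpace T] [TopologicalSpace S]
    {p : T → S} (hp : IsCoveringMap p) : IsClosed (Set.range p) := by
  rw [← isOpen_compl_iff, isOpen_iff_mem_nhds]
  intro x hx
  -- The trivialization over `U` has the fiber over `x` as its model, so a point of the range in `U`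
  -- yields a preimage of `x`.
  obtain ⟨-, U, hxU, hU, -, H, hH⟩ := hp x
  refine Filter.mem_of_superset (hU.mem_nhds hxU) ?_
  rintro _ hy ⟨z, rfl⟩
  exact hx ⟨_, (H ⟨z, hy⟩).2.2⟩

theorem IsCoveringMap.surjective {T S : Type*} [TopologicalSpace T] [Nonempty T]
    [TopologicalSpace S] [PreconnectedSpace S] {p : T → S} (hp : IsCoveringMap p) :
    Function.Surjective p :=
  Set.range_eq_univ.1
    (IsClopen.eq_univ ⟨hp.isClosed_range, hp.isOpenMap.isOpen_range⟩ (Set.range_nonempty p))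

/-- The deck transformations of a simply connected covering act transitively on the fibers. -/
theorem IsCoveringMap.exists_mem_deckGroup_apply_eq {T S : Type*} [TopologicalSpace T]
    [SimplyConnectedSpace T] [LocallyPathConnectedSpace T] [TopologicalSpace S] {p : T → S}
    (hp : IsCoveringMap p) {x y : T} (h : p x = p y) :
    ∃ γ : deckGroup p, (γ : T ≃ₜ T) x = y := by
  have hlift : ∀ {x y : T}, p x = p y → ∃ F : C(T, T), F x = y ∧ p ∘ F = p := fun {x y} h =>
    (hp.existsUnique_continuousMap_lifts ⟨p, hp.continuous⟩ x y h.symm).exists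
  obtain ⟨F, hFx, hF⟩ := hlift h
  obtain ⟨G, hGy, hG⟩ := hlift h.symm
  -- Both sides lift `p` through `p` and agree at one point.
  have hGF : G ∘ F = id := hp.eq_of_comp_eq (G.continuous.comp F.continuous) continuous_id
    (by rw [← Function.comp_assoc, hG, hF, Function.comp_id]) x (by simp [hFx, hGy])
  have hFG : F ∘ G = id := hp.eq_of_comp_eq (F.continuous.comp G.continuous) continuous_id
    (by rw [← Function.comp_assoc, hF, hG, Function.comp_id]) y (by simp [hFx, hGy])
  exact ⟨⟨⟨⟨F, G, congrFun hGF, congrFun hFG⟩, F.continuous, G.continuous⟩, congrFun hF⟩, hFx⟩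

/-- The deck transformations of a simply connected covering of a compact space act cocompactly. -/
theorem IsCoveringMap.exists_isCompact_forall_deckGroup {T S : Type*} [TopologicalSpace T]
    [SimplyConnectedSpace T] [LocallyPathConnectedSpace T] [LocallyCompactSpace T]
    [TopologicalSpace S] [CompactSpace S] [PreconnectedSpace S] {p : T → S}
    (hp : IsCoveringMap p) :
    ∃ K : Set T, IsCompact K ∧ ∀ z, ∃ γ : deckGroup p, (γ : T ≃ₜ T) z ∈ K := by
  choose q hq using hp.surjective
  -- Compact neighborhoods of chosen preimages; their images contain neighborhoods of all points of
  -- `S`, so finitely many cover it.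
  choose N hN hNq using fun s : S => exists_compact_mem_nhds (q s)
  obtain ⟨t, -, ht⟩ := isCompact_univ.elim_nhds_subcover (fun s => p '' N s) fun s _ => by
    have := hp.isOpenMap.image_mem_nhds (hNq s)
    rwa [hq] at this
  refine ⟨⋃ s ∈ t, N s, t.isCompact_biUnion fun s _ => hN s, fun z => ?_⟩
  obtain ⟨s, hs, y, hy, hyz⟩ : ∃ s ∈ t, ∃ y ∈ N s, p y = p z := by
    simpa using ht (Set.mem_univ (p z))
  obtain ⟨γ, hγ⟩ := hp.exists_mem_deckGroup_apply_eq hyz.symm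
  exact ⟨γ, Set.mem_biUnion hs (hγ ▸ hy)⟩

end Covering

/-! ## Leafwise holomorphic functions on projective foliated bundles -/

namespace FoliatedBundle

variable {𝕜 : Type*} [RCLike 𝕜] {T S : Type*} [TopologicalSpace T] {p : T → S}
  {W : Type*} [NormedAddCommGroup W] [NormedSpace 𝕜 W] [FiniteDimensional 𝕜 W]
  {ρ : deckGroup p →* LinearMap.GeneralLinearGroup 𝕜 W}

open Classical in
/-- The pull-back to `T × W` of a function on a projective foliated bundle, extended by zero. -/
noncomputable def homogeneousLift (f : FoliatedBundle p ((projectiveAction 𝕜 W).comp ρ) → ℂ) (z : T)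
    (w : W) : ℂ :=
  if h : w ≠ 0 then f (leafMap p ((projectiveAction 𝕜 W).comp ρ) (Projectivization.mk 𝕜 w h) z)
  else 0

variable {f : FoliatedBundle p ((projectiveAction 𝕜 W).comp ρ) → ℂ}

theorem homogeneousLift_of_ne_zero (z : T) {w : W} (h : w ≠ 0) : homogeneousLift f z w =
    f (leafMap p ((projectiveAction 𝕜 W).comp ρ) (Projectivization.mk 𝕜 w h) z) :=
  dif_pos h

theorem homogeneousLift_zero (z : T) : homogeneousLift f z (0 : W) = 0 :=
  dif_neg (not_not_intro rfl)

theorem homogeneousLift_smul (z : T) {a : 𝕜} (ha : a ≠ 0) (w : W) :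
    homogeneousLift f z (a • w) = homogeneousLift f z w := by
  by_cases hw : w = 0
  · rw [hw, smul_zero]
  · rw [homogeneousLift_of_ne_zero z hw, homogeneousLift_of_ne_zero z (smul_ne_zero ha hw),
      (Projectivization.mk_eq_mk_iff 𝕜 (a • w) w (smul_ne_zero ha hw) hw).2 ⟨Units.mk0 a ha, rfl⟩]

theorem homogeneousLift_deckGroup_smul (γ : deckGroup p) (z : T) (w : W) :
    homogeneousLift f ((γ : T ≃ₜ T) z) (ρ γ • w) = homogeneousLift f z w := by
  by_cases hw : w = 0
  · rw [hw, smul_zero, homogeneousLift_zero, homogeneousLift_zero]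
  · rw [homogeneousLift_of_ne_zero z hw,
      homogeneousLift_of_ne_zero _ ((smul_ne_zero_iff_ne (ρ γ)).2 hw)]
    refine congrArg f (Eq.symm ?_)
    exact Quotient.sound (s := foliatedBundleSetoid p ((projectiveAction 𝕜 W).comp ρ))
      (a := (z, Projectivization.mk 𝕜 w hw)) ⟨γ, rfl⟩

theorem continuousOn_homogeneousLift (hf : Continuous f) :
    ContinuousOn (fun q : T × W => homogeneousLift f q.1 q.2) {q | q.2 ≠ 0} := by
  rw [continuousOn_iff_continuous_domRestrict]
  have h1 : Continuous fun v : { v : W // v ≠ 0 } => Projectivization.mk 𝕜 (v : W) v.2 :=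
    continuous_coinduced_rng
  have h2 : Continuous fun a : T × ℙ 𝕜 W =>
      leafMap p ((projectiveAction 𝕜 W).comp ρ) a.2 a.1 := continuous_coinduced_rng
  have h3 : Continuous fun q : {q : T × W | q.2 ≠ 0} => (⟨q.1.2, q.2⟩ : { v : W // v ≠ 0 }) :=
    (continuous_snd.comp continuous_subtype_val).subtype_mk _
  convert hf.comp (h2.comp ((continuous_fst.comp continuous_subtype_val).prodMk (h1.comp h3)))
    using 1
  ext q
  exact homogeneousLift_of_ne_zero _ q.2

theorem exists_norm_homogeneousLift_le (hf : Continuous f) {K : Set T} (hK : IsCompact K)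
    (hcov : ∀ z, ∃ γ : deckGroup p, (γ : T ≃ₜ T) z ∈ K) :
    ∃ C, ∀ z w, ‖homogeneousLift f z w‖ ≤ C := by
  have : ProperSpace W := FiniteDimensional.proper_rclike 𝕜 W
  obtain ⟨C, hC⟩ := (hK.prod (isCompact_sphere (0 : W) 1)).exists_bound_of_continuousOn
    ((continuousOn_homogeneousLift hf).mono fun q hq =>
      ne_zero_of_mem_unit_sphere (⟨q.2, hq.2⟩ : Metric.sphere (0 : W) 1))
  refine ⟨max C 0, fun z w => ?_⟩
  by_cases hw : w = 0
  · rw [hw, homogeneousLift_zero, norm_zero]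
    exact le_max_right _ _
  · obtain ⟨γ, hγ⟩ := hcov z
    have hw' : ‖ρ γ • w‖ ≠ 0 := norm_ne_zero_iff.2 ((smul_ne_zero_iff_ne (ρ γ)).2 hw)
    have ha : ((‖ρ γ • w‖⁻¹ : ℝ) : 𝕜) ≠ 0 := RCLike.ofReal_ne_zero.2 (inv_ne_zero hw')
    rw [← homogeneousLift_deckGroup_smul γ, ← homogeneousLift_smul _ ha]
    refine (hC (_, _) ⟨hγ, ?_⟩).trans (le_max_left _ _)
    rw [mem_sphere_zero_iff_norm, norm_smul, RCLike.norm_ofReal, abs_inv, abs_norm,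
      inv_mul_cancel₀ hw']

variable {E : Type*} [NormedAddCommGroup E] [NormedSpace ℂ E] [ChartedSpace E T]

theorem mdifferentiable_homogeneousLift (hf : IsLeafwiseHolomorphic E f) (w : W) :
    MDifferentiable 𝓘(ℂ, E) 𝓘(ℂ, ℂ) fun z => homogeneousLift f z w := by
  by_cases hw : w = 0
  · simp only [hw, homogeneousLift_zero]
    exact mdifferentiable_const
  · simp only [homogeneousLift_of_ne_zero _ hw]
    exact hf _

theorem isHomogeneousFamily_homogeneousLift [NormedSpace ℝ W] [IsScalarTower ℝ 𝕜 W]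
    (hf : Continuous f) (hfh : IsLeafwiseHolomorphic E f) {C : ℝ}
    (hC : ∀ z w, ‖homogeneousLift f z w‖ ≤ C) : IsHomogeneousFamily E (homogeneousLift f) C where
  continuousOn := continuousOn_homogeneousLift hf
  smul_eq z r w hr := by
    rw [← algebraMap_smul 𝕜 r w]
    exact homogeneousLift_smul z ((map_ne_zero (algebraMap ℝ 𝕜)).2 hr) w
  norm_le := hC
  mdifferentiable := mdifferentiable_homogeneousLift hfh

theorem homogeneousLift_eq_of_isProximal [FiniteDimensional ℂ E] [IsManifold 𝓘(ℂ, E) ω T]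
    [PreconnectedSpace T] [Nonempty T] (hf : Continuous f) (hfh : IsLeafwiseHolomorphic E f)
    {K : Set T} (hK : IsCompact K) (hcov : ∀ z, ∃ γ : deckGroup p, (γ : T ≃ₜ T) z ∈ K)
    {γ : deckGroup p} (hγ : IsProximal (ρ γ)) (z : T) {x y : W} (hx : x ≠ 0) (hy : y ≠ 0) :
    homogeneousLift f z x = homogeneousLift f z y := by
  rcases Nat.lt_or_ge (Module.finrank 𝕜 W) 2 with hW | hW
  -- In dimension at most one all nonzero vectors are proportional, so homogeneity suffices.
  · obtain ⟨v, hv⟩ := finrank_le_one_iff.1 (Nat.le_of_lt_succ hW)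
    obtain ⟨a, rfl⟩ := hv x
    obtain ⟨b, rfl⟩ := hv y
    rw [homogeneousLift_smul z (left_ne_zero_of_smul hx),
      homogeneousLift_smul z (left_ne_zero_of_smul hy)]
  let : NormedSpace ℝ W := NormedSpace.restrictScalars ℝ 𝕜 W
  have : IsScalarTower ℝ 𝕜 W := IsScalarTower.of_algebraMap_smul fun _ _ => rfl
  have : FiniteDimensional ℝ W := Module.Finite.trans 𝕜 W
  obtain ⟨C, hC⟩ := exists_norm_homogeneousLift_le hf hK hcov
  obtain ⟨A, hA0, hA, m, c, hc, hlim⟩ := exists_tendsto_singular_of_isProximal hγ hW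
  let l : deckGroup p → W ≃L[ℝ] W := fun δ => ContinuousLinearEquiv.restrictScalars ℝ
    (LinearMap.GeneralLinearGroup.generalLinearEquiv 𝕜 W (ρ δ)).toContinuousLinearEquiv
  refine (isHomogeneousFamily_homogeneousLift hf hfh hC).eq_of_tendsto_singular
    (fun δ : deckGroup p => (δ : T ≃ₜ T)) (fun δ => (δ : T ≃ₜ T).surjective) l
    (fun δ => homogeneousLift_deckGroup_smul δ) hK hcov (A := A.restrictScalars ℝ) ?_ hA
    (g := fun j => γ ^ m j) hc ?_ z hx hy
  · intro h
    exact hA0 (ContinuousLinearMap.ext fun w => congrArg (fun B : W →L[ℝ] W => B w) h)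
  · have h := ((ContinuousLinearMap.restrictScalarsL 𝕜 W W ℝ ℝ).continuous.tendsto A).comp hlim
    refine h.congr fun j => ContinuousLinearMap.ext fun w => ?_
    have h1 : (l (γ ^ m j) : W →L[ℝ] W) w = ρ γ ^ m j • w := by
      rw [← map_pow]
      rfl
    rw [smul_apply, h1, ← algebraMap_smul 𝕜 (c j)]
    rfl

end FoliatedBundle

theorem mainTheorem6
    {𝕜 : Type*} [RCLike 𝕜]
    {E : Type*} [NormedAddCommGroup E] [NormedSpace ℂ E] [FiniteDimensional ℂ E]
    {S : Type*} [TopologicalSpace S] [T2Space S] [CompactSpace S] [ConnectedSpace S]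
    [ChartedSpace E S] [IsManifold 𝓘(ℂ, E) ω S]
    {T : Type*} [TopologicalSpace T] [ChartedSpace E T] [IsManifold 𝓘(ℂ, E) ω T]
    (p : T → S) (hp : IsHolomorphicUniversalCovering E p)
    {W : Type*} [NormedAddCommGroup W] [NormedSpace 𝕜 W] [FiniteDimensional 𝕜 W]
    (ρ : deckGroup p →* LinearMap.GeneralLinearGroup 𝕜 W)
    (hρ : ∃ γ : deckGroup p, IsProximal (ρ γ)) :
    FoliatedBundle.HolomorphicallyPlain p ((projectiveAction 𝕜 W).comp ρ) E := by
  intro f hf hfh x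
  obtain ⟨γ, hγ⟩ := hρ
  have := hp.simplyConnected
  have : ProperSpace E := FiniteDimensional.proper ℂ E
  have : LocallyPathConnectedSpace E :=
    letI := NormedSpace.restrictScalars ℝ ℂ E
    inferInstance
  have : LocallyPathConnectedSpace T := ChartedSpace.locallyPathConnectedSpace E T
  have : LocallyCompactSpace T := ChartedSpace.locallyCompactSpace E T
  obtain ⟨K, hK, hcov⟩ := hp.isCoveringMap.exists_isCompact_forall_deckGroup
  induction x using Projectivization.ind with
  | h w hw =>
  -- Equivariance moves both z and w; independence of w turns it into invariance in z for fixed `w`.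
  have hinv : ∀ (δ : deckGroup p) (z : T), FoliatedBundle.homogeneousLift f ((δ : T ≃ₜ T) z) w =
      FoliatedBundle.homogeneousLift f z w := fun δ z => by
    rw [← FoliatedBundle.homogeneousLift_deckGroup_smul δ z w]
    exact FoliatedBundle.homogeneousLift_eq_of_isProximal hf hfh hK hcov hγ _ hw
      ((smul_ne_zero_iff_ne (ρ δ)).2 hw)
  have hd := FoliatedBundle.mdifferentiable_homogeneousLift hfh w
  obtain ⟨z₀⟩ : Nonempty T := inferInstance
  obtain ⟨δ₀, hδ₀⟩ := hcov z₀
  obtain ⟨c, -, hmax⟩ := hK.exists_isMaxOn ⟨_, hδ₀⟩ hd.continuous.norm.continuousOn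
  have hconst := eq_of_norm_le_of_mdifferentiable hd (c := c) fun z => by
    obtain ⟨δ, hδ⟩ := hcov z
    rw [← hinv δ]
    exact hmax hδ
  rintro _ ⟨z₁, rfl⟩ _ ⟨z₂, rfl⟩
  have h := (hconst z₁).trans (hconst z₂).symm
  rwa [FoliatedBundle.homogeneousLift_of_ne_zero z₁ hw,
    FoliatedBundle.homogeneousLift_of_ne_zero z₂ hw] at h
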